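/- Let $G$ be a solvable group (not necessarily finite) of derived length $d$, i.e. $d$ is the least integer $n\ge 0$ with $G^{(n)}=1$, where $G^{(0)}=G$ and $G^{(n+1)}=[G^{(n)},G^{(n)}]$, and suppose that $G$ has finite exponent $\exp(G)$. Write ${}^{a}b=aba^{-1}$ and $[a,b]=aba^{-1}b^{-1}$. Let $G\otimes G$ be the nonabelian tensor square of $G$: the group generated by the symbols $g\otimes h$ $(g,h\in G)$ subject to the relations $gg'\otimes h=({}^{g}g'\otimes{}^{g}h)(g\otimes h)$ and $g\otimes hh'=(g\otimes h)({}^{h}g\otimes{}^{h}h')$ for all $g,g',h,h'\in G$. Let $G\wedge G=(G\otimes G)/\nabla(G)$, where $\nabla(G)$ is the subgroup generated by all $x\otimes x$, and let $\kappa:G\wedge G\to G'$ be the homomorphism to the commutator subgroup $G'=[G,G]$ induced by $g\otimes h\mapsto[g,h]$. (i) If $\exp(G)$ is odd, then $\exp(G\otimes G)$ divides $\exp(G)^{d}$. In particular, the exponents of the Schur multiplier $H_2(G,\mathbb Z)$ and of $\ker\kappa$ divide $\exp(G)^{d}$. (ii) If $\exp(G)$ is even, then $\exp(G\otimes G)$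 divides $2^{d-1}\exp(G)^{d}$. In particular, the exponents of the Schur multiplier $H_2(G,\mathbb Z)$ and of $\ker\kappa$ divide $2^{d-1}\exp(G)^{d}$. -/

import Mathlib

universe u

open scoped commutatorElement

/-- The derived length of a solvable group: the least `n` with `G⁽ⁿ⁾ = 1`
(with the usual indexing `G⁽⁰⁾ = G`). -/
noncomputable def derivedLength (G : Type u) [Group G] : ℕ :=
  sInf {n : ℕ | derivedSeries G n = ⊥}

/-- The defining relators of the nonabelian tensor square, in the free group on the symbols
`(g, h)`; they say, with `ᵃb = a b a⁻¹`,
`gg' ⊗ h = (ᵍg' ⊗ ᵍh)(g ⊗ h)` and `g ⊗ hh' = (g ⊗ h)(ʰg ⊗ ʰh')`. -/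
def tensorSquareRels (G : Type u) [Group G] : Set (FreeGroup (G × G)) :=
  {r | ∃ g g' h : G, r = FreeGroup.of (g * g', h) *
      (FreeGroup.of (g * g' * g⁻¹, g * h * g⁻¹) * FreeGroup.of (g, h))⁻¹} ∪
  {r | ∃ g h h' : G, r = FreeGroup.of (g, h * h') *
      (FreeGroup.of (g, h) * FreeGroup.of (h * g * h⁻¹, h * h' * h⁻¹))⁻¹}

/-- The nonabelian tensor square `G ⊗ G`, where `G` acts on itself by conjugation. -/
abbrev NATensorSquare (G : Type u) [Group G] : Type u :=
  PresentedGroup (tensorSquareRels G)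

namespace NATensorSquare

variable {G : Type u} [Group G]

/-- The generator `g ⊗ h`. -/
def tmul (g h : G) : NATensorSquare G := PresentedGroup.of (g, h)

theorem mul_tmul (g g' h : G) :
    tmul (g * g') h = tmul (g * g' * g⁻¹) (g * h * g⁻¹) * tmul g h := by
  have hr : PresentedGroup.mk (tensorSquareRels G) (FreeGroup.of (g * g', h) *
      (FreeGroup.of (g * g' * g⁻¹, g * h * g⁻¹) * FreeGroup.of (g, h))⁻¹) = 1 :=
    PresentedGroup.one_of_mem (Or.inl ⟨g, g', h, rfl⟩)
  rw [map_mul, map_inv, map_mul] at hr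
  exact mul_inv_eq_one.mp hr

theorem tmul_mul (g h h' : G) :
    tmul g (h * h') = tmul g h * tmul (h * g * h⁻¹) (h * h' * h⁻¹) := by
  have hr : PresentedGroup.mk (tensorSquareRels G) (FreeGroup.of (g, h * h') *
      (FreeGroup.of (g, h) * FreeGroup.of (h * g * h⁻¹, h * h' * h⁻¹))⁻¹) = 1 :=
    PresentedGroup.one_of_mem (Or.inr ⟨g, h, h', rfl⟩)
  rw [map_mul, map_inv, map_mul] at hr
  exact mul_inv_eq_one.mp hr

/-- Conjugation by `g ⊗ h` is the diagonal action of `[g, h]` on generators. -/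
theorem conj_tmul (g h a b : G) :
    tmul g h * tmul a b * (tmul g h)⁻¹ =
      tmul (⁅g, h⁆ * a * ⁅g, h⁆⁻¹) (⁅g, h⁆ * b * ⁅g, h⁆⁻¹) := by
  have key : ∀ g' h' : G,
      tmul (g * h * g' * h⁻¹ * g⁻¹) (g * h * h' * h⁻¹ * g⁻¹) * tmul g h =
        tmul g h * tmul (h * g * g' * g⁻¹ * h⁻¹) (h * g * h' * g⁻¹ * h⁻¹) := by
    intro g' h'
    have e1 : tmul (g * g') (h * h') =
        tmul (g * g' * g⁻¹) (g * h * g⁻¹) *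
          (tmul (g * h * g' * h⁻¹ * g⁻¹) (g * h * h' * h⁻¹ * g⁻¹) * tmul g h) *
          tmul (h * g * h⁻¹) (h * h' * h⁻¹) := by
      rw [mul_tmul, tmul_mul g h h',
        show g * (h * h') * g⁻¹ = (g * h * g⁻¹) * (g * h' * g⁻¹) by group, tmul_mul]
      simp only [mul_assoc, mul_inv_rev, inv_inv, inv_mul_cancel_left]
    have e2 : tmul (g * g') (h * h') =
        tmul (g * g' * g⁻¹) (g * h * g⁻¹) *
          (tmul g h * tmul (h * g * g' * g⁻¹ * h⁻¹) (h * g * h' * g⁻¹ * h⁻¹)) *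
          tmul (h * g * h⁻¹) (h * h' * h⁻¹) := by
      rw [tmul_mul, mul_tmul g g' h,
        show h * (g * g') * h⁻¹ = (h * g * h⁻¹) * (h * g' * h⁻¹) by group,
        mul_tmul (h * g * h⁻¹)]
      simp only [mul_assoc, mul_inv_rev, inv_inv, inv_mul_cancel_left]
    exact mul_left_cancel (mul_right_cancel (e1.symm.trans e2))
  have k := key (g⁻¹ * h⁻¹ * a * h * g) (g⁻¹ * h⁻¹ * b * h * g)
  rw [show h * g * (g⁻¹ * h⁻¹ * a * h * g) * g⁻¹ * h⁻¹ = a by group,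
    show h * g * (g⁻¹ * h⁻¹ * b * h * g) * g⁻¹ * h⁻¹ = b by group] at k
  rw [← k, mul_inv_cancel_right, commutatorElement_def]
  congr 1 <;> group

/-- The commutator map `κ : G ⊗ G → G'`, `g ⊗ h ↦ [g, h]`. -/
def kappa (G : Type u) [Group G] : NATensorSquare G →* commutator G :=
  PresentedGroup.toGroup
    (f := fun x : G × G =>
      (⟨⁅x.1, x.2⁆, Subgroup.commutator_mem_commutator (Subgroup.mem_top _)
        (Subgroup.mem_top _)⟩ : commutator G))
    (by
      rintro r (⟨g, g', h, rfl⟩ | ⟨g, h, h', rfl⟩) <;>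
      · apply Subtype.ext
        simp only [map_mul, map_inv, FreeGroup.lift_apply_of, Subgroup.coe_mul,
          Subgroup.coe_inv, Subgroup.coe_one, commutatorElement_def]
        group)

@[simp]
theorem kappa_tmul (g h : G) : ((kappa G (tmul g h) : commutator G) : G) = ⁅g, h⁆ := by
  simp [kappa, tmul]

/-- `∇(G)`: the subgroup of `G ⊗ G` generated by the elements `x ⊗ x`. -/
def nabla (G : Type u) [Group G] : Subgroup (NATensorSquare G) :=
  Subgroup.closure (Set.range fun x : G => tmul x x)

instance nabla_normal (G : Type u) [Group G] : (nabla G).Normal := by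
  have hgen : Subgroup.closure (Set.range fun x : G × G => tmul x.1 x.2) = ⊤ :=
    PresentedGroup.closure_range_of (tensorSquareRels G)
  -- conjugation by a generator maps `∇(G)` into itself
  have hmem : ∀ (g h : G) (n : NATensorSquare G), n ∈ nabla G →
      tmul g h * n * (tmul g h)⁻¹ ∈ nabla G := by
    intro g h n hn
    have hle : nabla G ≤ (nabla G).comap (MulAut.conj (tmul g h)).toMonoidHom := by
      refine (Subgroup.closure_le _).2 ?_
      rintro _ ⟨x, rfl⟩
      refine Subgroup.subset_closure ⟨⁅g, h⁆ * x * ⁅g, h⁆⁻¹, ?_⟩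
      simpa using (conj_tmul g h x x).symm
    simpa using hle hn
  -- so does conjugation by its inverse
  have hinv : ∀ (g h : G) (n : NATensorSquare G), n ∈ nabla G →
      (tmul g h)⁻¹ * n * tmul g h ∈ nabla G := by
    intro g h n hn
    have hle : nabla G ≤ (nabla G).comap (MulAut.conj (tmul g h)⁻¹).toMonoidHom := by
      refine (Subgroup.closure_le _).2 ?_
      rintro _ ⟨x, rfl⟩
      refine Subgroup.subset_closure ⟨⁅g, h⁆⁻¹ * x * ⁅g, h⁆, ?_⟩
      have e := conj_tmul g h (⁅g, h⁆⁻¹ * x * ⁅g, h⁆) (⁅g, h⁆⁻¹ * x * ⁅g, h⁆)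
      rw [show ⁅g, h⁆ * (⁅g, h⁆⁻¹ * x * ⁅g, h⁆) * ⁅g, h⁆⁻¹ = x by group] at e
      simp only [MulEquiv.coe_toMonoidHom, MulAut.conj_apply, ← e]
      group
    simpa using hle hn
  refine ⟨fun n hn t => ?_⟩
  have ht : t ∈ Subgroup.closure (Set.range fun x : G × G => tmul x.1 x.2) := by
    rw [hgen]; trivial
  induction ht using Subgroup.closure_induction_left generalizing n with
  | one => simpa using hn
  | mul_left x hx y hy ih =>
    obtain ⟨⟨g, h⟩, rfl⟩ := hx
    simpa [mul_assoc] using hmem g h _ (ih n hn)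
  | inv_mul_cancel x hx y hy ih =>
    obtain ⟨⟨g, h⟩, rfl⟩ := hx
    simpa [mul_assoc] using hinv g h _ (ih n hn)

end NATensorSquare

/-- The exterior square `G ∧ G = (G ⊗ G) / ∇(G)`. -/
abbrev NAExteriorSquare (G : Type u) [Group G] : Type u :=
  NATensorSquare G ⧸ NATensorSquare.nabla G

/-- The commutator map `κ : G ∧ G → G'` induced on the exterior square. -/
def NAExteriorSquare.kappa (G : Type u) [Group G] : NAExteriorSquare G →* commutator G :=
  QuotientGroup.lift (NATensorSquare.nabla G) (NATensorSquare.kappa G) (by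
    refine (Subgroup.closure_le _).2 ?_
    rintro _ ⟨x, rfl⟩
    apply Subtype.ext
    simp)

/-- The kernel of the commutator map `κ : G ∧ G → G'`. -/
abbrev kerCommutatorMap (G : Type u) [Group G] : Subgroup (NAExteriorSquare G) :=
  (NAExteriorSquare.kappa G).ker

/-- The second integral homology group `H₂(G, ℤ)` (trivial action), i.e. the Schur multiplier.
Mathlib wants the coefficient ring in the universe of `G`, hence the `ULift` of `ℤ`. -/
noncomputable abbrev IntegralH2 (G : Type u) [Group G] : Type u :=
  groupHomology.H2 (Rep.trivial (ULift.{u} ℤ) G (ULift.{u} ℤ))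

/-! The proof is an induction on the derived length, removing the last nontrivial derived subgroup
`N`, which is abelian and normal. The kernel of `G ⊗ G → G/N ⊗ G/N` is `mixed N`, and only the part
needed here is built: a surjection `ofQuotient` from `G/N ⊗ G/N` onto `(G ⊗ G) / mixed N`.

An element `x` of `G ⊗ G` conjugates generators through `κ(x)`. On `mixed N` this lies in `N`, so
`inner N` is central in `mixed N` and commutators of `mixed N` fall into `inner N`. With `e =
exp(G)`, `inner N` is killed by `e`, and powers in `mixed N` produce corrections in `inner N` with
exponent `k.choose 2`. Hence `k` kills `mixed N` once `e` divides `k` and `k.choose 2`: `k = e` for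
odd `e`, `k = 2e` for even `e`. The abelian base case costs only `e`, whence `2 ^ (d - 1)`.

For `H₂`, the commutator subgroup of any central extension of `G` is an image of `G ⊗ G`, and `H₂`
embeds in the commutator subgroup of a tautological one. The bound for `ker κ` is inherited from the
quotient `G ∧ G`. -/

/-- Powers of a product whose factors commute up to a central factor. -/
theorem mul_pow_of_commutes_up_to {H : Type*} [Group H] {x y c : H} (h : y * x = x * y * c)
    (hx : Commute c x) (hy : Commute c y) (k : ℕ) :
    (x * y) ^ k = x ^ k * y ^ k * c ^ k.choose 2 := by
  -- Moving `y ^ k` past one `x` costs `c ^ k`; summing `0 + 1 + ... + (k - 1)` gives the binomial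
  -- coefficient.
  have hyk : ∀ k : ℕ, y ^ k * x = x * y ^ k * c ^ k := by
    intro k
    induction k with
    | zero => simp
    | succ k ih =>
      calc y ^ (k + 1) * x = y ^ k * (y * x) := by rw [pow_succ, mul_assoc]
        _ = (y ^ k * x) * (y * c) := by rw [h]; simp only [mul_assoc]
        _ = x * y ^ k * (c ^ k * y) * c := by rw [ih]; simp only [mul_assoc]
        _ = x * y ^ (k + 1) * c ^ (k + 1) := by
          rw [(hy.pow_left k).eq, pow_succ, pow_succ]; simp only [mul_assoc]
  induction k with
  | zero => simp
  | succ k ih =>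
    have hc : Commute (c ^ k.choose 2) (x * y) := (hx.mul_right hy).pow_left _
    calc (x * y) ^ (k + 1) = x ^ k * y ^ k * (c ^ k.choose 2 * (x * y)) := by
          rw [pow_succ, ih, mul_assoc]
      _ = x ^ k * (y ^ k * x) * y * c ^ k.choose 2 := by rw [hc.eq]; simp only [mul_assoc]
      _ = x ^ k * x * y ^ k * (c ^ k * y) * c ^ k.choose 2 := by
          rw [hyk]; simp only [mul_assoc]
      _ = x ^ (k + 1) * y ^ (k + 1) * c ^ (k + 1).choose 2 := by
          rw [(hy.pow_left k).eq, Nat.choose_succ_succ' k 1, Nat.choose_one_right, pow_add c,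
            pow_succ x, pow_succ y]
          simp only [mul_assoc]

/-! ### Conjugation and powers in the tensor square -/

namespace NATensorSquare

variable {G : Type u} [Group G]

theorem closure_tmul : Subgroup.closure (Set.range fun x : G × G => tmul x.1 x.2) = ⊤ :=
  PresentedGroup.closure_range_of (tensorSquareRels G)

@[simp]
theorem one_tmul (h : G) : tmul 1 h = 1 := by
  have := mul_tmul (1 : G) 1 h
  simpa using this

@[simp]
theorem tmul_one (g : G) : tmul g 1 = 1 := by
  have := tmul_mul g (1 : G) 1
  simpa using this

theorem conj_tmul_eq (x : NATensorSquare G) (a b : G) :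
    x * tmul a b * x⁻¹ =
      tmul ((kappa G x : G) * a * (kappa G x : G)⁻¹) ((kappa G x : G) * b * (kappa G x : G)⁻¹) := by
  have hx : x ∈ Subgroup.closure (Set.range fun x : G × G => tmul x.1 x.2) := by
    rw [closure_tmul]; trivial
  induction hx using Subgroup.closure_induction generalizing a b with
  | mem x hx =>
    obtain ⟨⟨g, h⟩, rfl⟩ := hx
    simpa using conj_tmul g h a b
  | one => simp
  | mul x y _ _ hx hy =>
    rw [show x * y * tmul a b * (x * y)⁻¹ = x * (y * tmul a b * y⁻¹) * x⁻¹ by group, hy, hx]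
    simp [mul_assoc]
  | inv x _ hx =>
    set c : G := (kappa G x : G)
    have e := hx (c⁻¹ * a * c) (c⁻¹ * b * c)
    rw [show c * (c⁻¹ * a * c) * c⁻¹ = a by group, show c * (c⁻¹ * b * c) * c⁻¹ = b by group] at e
    rw [← e]
    simp only [map_inv, Subgroup.coe_inv, inv_inv]
    change _ = tmul (c⁻¹ * a * c) (c⁻¹ * b * c)
    group

theorem pow_tmul_of_commute {g h : G} (hc : Commute g h) (k : ℕ) :
    tmul (g ^ k) h = tmul g h ^ k := by
  induction k with
  | zero => simp
  | succ k ih =>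
    rw [pow_succ', mul_tmul, hc.eq, mul_inv_cancel_right, (Commute.self_pow g k).eq,
      mul_inv_cancel_right, ih, pow_succ]

theorem tmul_pow_of_commute {g h : G} (hc : Commute g h) (k : ℕ) :
    tmul g (h ^ k) = tmul g h ^ k := by
  induction k with
  | zero => simp
  | succ k ih =>
    rw [pow_succ', tmul_mul, ← hc.eq, mul_inv_cancel_right, (Commute.self_pow h k).eq,
      mul_inv_cancel_right, ih, pow_succ']

/-- The tensor square of an abelian group inherits its exponent. -/
theorem pow_eq_one_of_commutative (hG : ∀ a b : G, Commute a b) {e : ℕ}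
    (he : ∀ g : G, g ^ e = 1) (x : NATensorSquare G) : x ^ e = 1 := by
  have hcomm : ∀ (y : NATensorSquare G) (a b : G), Commute y (tmul a b) := by
    intro y a b
    have h := conj_tmul_eq y a b
    rw [(hG _ a).eq, (hG _ b).eq, mul_inv_cancel_right, mul_inv_cancel_right] at h
    exact mul_inv_eq_iff_eq_mul.mp h
  have hx : x ∈ Subgroup.closure (Set.range fun x : G × G => tmul x.1 x.2) := by
    rw [closure_tmul]; trivial
  induction hx using Subgroup.closure_induction_right with
  | one => simp
  | mul_right x hx y hy ih =>
    obtain ⟨⟨g, h⟩, rfl⟩ := hy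
    rw [(hcomm x g h).mul_pow, ih, ← pow_tmul_of_commute (hG g h), he, one_tmul, one_mul]
  | mul_inv_cancel x hx y hy ih =>
    obtain ⟨⟨g, h⟩, rfl⟩ := hy
    rw [(hcomm x g h).inv_right.mul_pow, ih, inv_pow, ← pow_tmul_of_commute (hG g h), he, one_tmul,
      one_mul, inv_one]

/-! ### The contribution of an abelian normal subgroup -/

section NormalSubgroup

variable (N : Subgroup G)

/-- The subgroup of `G ⊗ G` generated by the elements `n ⊗ g` and `g ⊗ n` with `n ∈ N`. -/
def mixed : Subgroup (NATensorSquare G) :=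
  Subgroup.closure {x | ∃ n ∈ N, ∃ g : G, x = tmul n g ∨ x = tmul g n}

/-- The subgroup of `G ⊗ G` generated by the elements `n ⊗ m` with `n, m ∈ N`. -/
def inner : Subgroup (NATensorSquare G) :=
  Subgroup.closure {x | ∃ n ∈ N, ∃ m ∈ N, x = tmul n m}

variable {N}

theorem tmul_mem_mixed_left {n : G} (hn : n ∈ N) (g : G) : tmul n g ∈ mixed N :=
  Subgroup.subset_closure ⟨n, hn, g, Or.inl rfl⟩

theorem tmul_mem_mixed_right {n : G} (hn : n ∈ N) (g : G) : tmul g n ∈ mixed N :=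
  Subgroup.subset_closure ⟨n, hn, g, Or.inr rfl⟩

theorem tmul_mem_inner {n m : G} (hn : n ∈ N) (hm : m ∈ N) : tmul n m ∈ inner N :=
  Subgroup.subset_closure ⟨n, hn, m, hm, rfl⟩

theorem inner_le_mixed : inner N ≤ mixed N := by
  refine (Subgroup.closure_le _).2 ?_
  rintro _ ⟨n, hn, m, -, rfl⟩
  exact tmul_mem_mixed_left hn m

variable [hN : N.Normal]

theorem commutator_mem {n : G} (hn : n ∈ N) (g : G) : ⁅n, g⁆ ∈ N := by
  rw [commutatorElement_def, mul_assoc, mul_assoc, ← mul_assoc g]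
  exact N.mul_mem hn (hN.conj_mem _ (N.inv_mem hn) g)

instance mixed_normal : (mixed N).Normal := by
  refine ⟨fun n hn t => ?_⟩
  have hle : mixed N ≤ (mixed N).comap (MulAut.conj t).toMonoidHom := by
    refine (Subgroup.closure_le _).2 ?_
    rintro _ ⟨n, hn, g, rfl | rfl⟩
    · simpa [conj_tmul_eq] using tmul_mem_mixed_left (hN.conj_mem _ hn _) _
    · simpa [conj_tmul_eq] using tmul_mem_mixed_right (hN.conj_mem _ hn _) _
  simpa using hle hn

theorem kappa_mem_of_mem_mixed {x : NATensorSquare G} (hx : x ∈ mixed N) :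
    (kappa G x : G) ∈ N := by
  have hle : mixed N ≤ N.comap ((commutator G).subtype.comp (kappa G)) := by
    refine (Subgroup.closure_le _).2 ?_
    rintro _ ⟨n, hn, g, rfl | rfl⟩
    · simpa using commutator_mem hn g
    · simpa [commutatorElement_inv] using N.inv_mem (commutator_mem hn g)
  exact hle hx

-- Since `m` fixes `n` and sends `g` to `⁅m, g⁆ * g`, the defining relation splits off one
-- correction factor. For normal `N` that factor lies in `inner N`. It governs both the commutators
-- in `mixed N` and the powers of its generators.
omit hN in
theorem conj_tmul_of_mem_left (hc : ∀ a ∈ N, ∀ b ∈ N, Commute a b) {m n : G} (hm : m ∈ N)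
    (hn : n ∈ N) (g : G) :
    tmul (m * n * m⁻¹) (m * g * m⁻¹) = tmul n g * tmul (g * n * g⁻¹) ⁅m, g⁆ := by
  rw [(hc m hm n hn).eq, mul_inv_cancel_right,
    show m * g * m⁻¹ = g * (g⁻¹ * ⁅m, g⁆ * g) by rw [commutatorElement_def]; group, tmul_mul]
  congr 2
  group

omit hN in
theorem conj_tmul_of_mem_right (hc : ∀ a ∈ N, ∀ b ∈ N, Commute a b) {m n : G} (hm : m ∈ N)
    (hn : n ∈ N) (g : G) :
    tmul (m * g * m⁻¹) (m * n * m⁻¹) = tmul ⁅m, g⁆ (g * n * g⁻¹) * tmul g n := by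
  rw [(hc m hm n hn).eq, mul_inv_cancel_right,
    show m * g * m⁻¹ = g * (g⁻¹ * ⁅m, g⁆ * g) by rw [commutatorElement_def]; group, mul_tmul]
  congr 2
  group

/-- Conjugation by `x` acts through `κ(x) ∈ N`, which fixes every `n ⊗ m` because `N` is abelian. -/
theorem commute_of_mem_inner (hc : ∀ a ∈ N, ∀ b ∈ N, Commute a b) {z x : NATensorSquare G}
    (hz : z ∈ inner N) (hx : x ∈ mixed N) : Commute z x := by
  have hk := kappa_mem_of_mem_mixed hx
  have hle : inner N ≤ Subgroup.centralizer {x} := by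
    refine (Subgroup.closure_le _).2 ?_
    rintro _ ⟨n, hn, m, hm, rfl⟩
    have h := conj_tmul_eq x n m
    rw [(hc _ hk n hn).eq, (hc _ hk m hm).eq, mul_inv_cancel_right, mul_inv_cancel_right] at h
    exact Subgroup.mem_centralizer_singleton_iff.2 (mul_inv_eq_iff_eq_mul.mp h).symm
  exact Subgroup.mem_centralizer_singleton_iff.1 (hle hz)

theorem pow_eq_one_of_mem_inner (hc : ∀ a ∈ N, ∀ b ∈ N, Commute a b) {e : ℕ}
    (he : ∀ g : G, g ^ e = 1) {z : NATensorSquare G} (hz : z ∈ inner N) : z ^ e = 1 := by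
  induction hz using Subgroup.closure_induction with
  | mem x hx =>
    obtain ⟨n, hn, m, hm, rfl⟩ := hx
    rw [← pow_tmul_of_commute (hc n hn m hm), he, one_tmul]
  | one => simp
  | mul x y hx hy ihx ihy =>
    rw [(commute_of_mem_inner hc hx (inner_le_mixed hy)).mul_pow, ihx, ihy, one_mul]
  | inv x _ ih => rw [inv_pow, ih, inv_one]

theorem commutator_pow (hc : ∀ a ∈ N, ∀ b ∈ N, Commute a b) {n : G} (hn : n ∈ N) (g : G) (k : ℕ) :
    ⁅n ^ k, g⁆ = ⁅n, g⁆ ^ k := by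
  have h : Commute n (g * n⁻¹ * g⁻¹) := hc _ hn _ (hN.conj_mem _ (N.inv_mem hn) g)
  rw [commutatorElement_def, commutatorElement_def, show n * g * n⁻¹ * g⁻¹ = n * (g * n⁻¹ * g⁻¹) by
    group, h.mul_pow, conj_pow, inv_pow]
  simp only [mul_assoc]

/-- Expanding `n ^ k * n` conjugates `n ⊗ g` by `n ^ k`; the correction is the `k`-th power of a
fixed element of `inner N`, and these exponents add up to `k.choose 2`. -/
theorem pow_tmul (hc : ∀ a ∈ N, ∀ b ∈ N, Commute a b) {n : G} (hn : n ∈ N) (g : G) (k : ℕ) :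
    tmul (n ^ k) g = tmul n g ^ k * tmul (g * n * g⁻¹) ⁅n, g⁆ ^ k.choose 2 := by
  have hz : tmul (g * n * g⁻¹) ⁅n, g⁆ ∈ inner N :=
    tmul_mem_inner (hN.conj_mem _ hn g) (commutator_mem hn g)
  have hzc := commute_of_mem_inner hc hz (tmul_mem_mixed_left hn g)
  induction k with
  | zero => simp
  | succ k ih =>
    rw [pow_succ, mul_tmul, conj_tmul_of_mem_left hc (N.pow_mem hn k) hn, commutator_pow hc hn,
      tmul_pow_of_commute (hc _ (hN.conj_mem _ hn g) _ (commutator_mem hn g)), ih,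
      show (k + 1).choose 2 = k + k.choose 2 by simp [Nat.choose_succ_succ' k 1]]
    generalize tmul (g * n * g⁻¹) ⁅n, g⁆ = z at hzc ⊢
    generalize tmul n g = t at hzc ⊢
    rw [mul_assoc, ← mul_assoc (z ^ k), (hzc.pow_pow k k).eq, pow_add z, pow_succ' t]
    simp only [mul_assoc]

theorem tmul_pow (hc : ∀ a ∈ N, ∀ b ∈ N, Commute a b) {n : G} (hn : n ∈ N) (g : G) (k : ℕ) :
    tmul g (n ^ k) = tmul g n ^ k * tmul ⁅n, g⁆ (g * n * g⁻¹) ^ k.choose 2 := by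
  have hz : tmul ⁅n, g⁆ (g * n * g⁻¹) ∈ inner N :=
    tmul_mem_inner (commutator_mem hn g) (hN.conj_mem _ hn g)
  have hzc := commute_of_mem_inner hc hz (tmul_mem_mixed_right hn g)
  induction k with
  | zero => simp
  | succ k ih =>
    rw [pow_succ, tmul_mul, conj_tmul_of_mem_right hc (N.pow_mem hn k) hn, commutator_pow hc hn,
      pow_tmul_of_commute (hc _ (commutator_mem hn g) _ (hN.conj_mem _ hn g)), ih,
      show (k + 1).choose 2 = k.choose 2 + k by simp [Nat.choose_succ_succ' k 1, add_comm]]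
    generalize tmul ⁅n, g⁆ (g * n * g⁻¹) = z at hzc ⊢
    generalize tmul g n = t at hzc ⊢
    rw [mul_assoc, ← mul_assoc (z ^ _), ← pow_add, (hzc.pow_left _).eq, pow_succ, mul_assoc]

/-- The mixed subgroup of an abelian normal subgroup `N` is nilpotent of class at most two,
so its exponent is controlled by that of its generators and of its commutators. -/
theorem pow_eq_one_of_mem_mixed (hc : ∀ a ∈ N, ∀ b ∈ N, Commute a b) {e k : ℕ}
    (he : ∀ g : G, g ^ e = 1) (hk : e ∣ k) (hk2 : e ∣ k.choose 2) {x : NATensorSquare G}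
    (hx : x ∈ mixed N) : x ^ k = 1 := by
  have hz : ∀ z ∈ inner N, z ^ k.choose 2 = 1 := by
    intro z hz
    obtain ⟨l, hl⟩ := hk2
    rw [hl, pow_mul, pow_eq_one_of_mem_inner hc he hz, one_pow]
  have hgk : ∀ g : G, g ^ k = 1 := by
    intro g
    obtain ⟨l, hl⟩ := hk
    rw [hl, pow_mul, he, one_pow]
  have hgen : ∀ n ∈ N, ∀ g : G, tmul n g ^ k = 1 ∧ tmul g n ^ k = 1 := by
    intro n hn g
    have h1 := pow_tmul hc hn g k
    have h2 := tmul_pow hc hn g k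
    rw [hz _ (tmul_mem_inner (hN.conj_mem _ hn g) (commutator_mem hn g)), hgk] at h1
    rw [hz _ (tmul_mem_inner (commutator_mem hn g) (hN.conj_mem _ hn g)), hgk] at h2
    exact ⟨by simpa using h1.symm, by simpa using h2.symm⟩
  -- Conjugating a generator by `y` is the diagonal action of `κ(y) ∈ N`, so it changes the
  -- generator only by an element of `inner N`.
  have hcomm : ∀ n ∈ N, ∀ g : G, ∀ y ∈ mixed N,
      (∃ z ∈ inner N, y * tmul n g = tmul n g * y * z) ∧
        (∃ z ∈ inner N, y * tmul g n = tmul g n * y * z) := by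
    intro n hn g y hy
    have hky := kappa_mem_of_mem_mixed hy
    have h1 := conj_tmul_eq y n g
    have h2 := conj_tmul_eq y g n
    rw [conj_tmul_of_mem_left hc hky hn] at h1
    rw [conj_tmul_of_mem_right hc hky hn] at h2
    have hz1 := tmul_mem_inner (hN.conj_mem _ hn g) (commutator_mem hky g)
    have hz2 := tmul_mem_inner (commutator_mem hky g) (hN.conj_mem _ hn g)
    rw [mul_inv_eq_iff_eq_mul] at h1 h2
    refine ⟨⟨_, hz1, ?_⟩, ⟨_, hz2, ?_⟩⟩
    · rw [h1, mul_assoc (tmul n g), mul_assoc (tmul n g), (commute_of_mem_inner hc hz1 hy).eq]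
    · rw [h2, mul_assoc _ (tmul g n), (commute_of_mem_inner hc hz2
        (mul_mem (tmul_mem_mixed_right hn g) hy)).eq]
  have step : ∀ x ∈ mixed N, ∀ y ∈ mixed N, x ^ k = 1 → y ^ k = 1 →
      (∃ z ∈ inner N, y * x = x * y * z) → (x * y) ^ k = 1 ∧ (x⁻¹ * y) ^ k = 1 := by
    rintro x hx y hy hxk hyk ⟨z, hzm, hxy⟩
    have hzx := commute_of_mem_inner hc hzm hx
    have hzy := commute_of_mem_inner hc hzm hy
    refine ⟨?_, ?_⟩
    · rw [mul_pow_of_commutes_up_to hxy hzx hzy, hxk, hyk, hz z hzm, one_mul, one_mul]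
    · have h : y * x⁻¹ = x⁻¹ * y * z⁻¹ := by
        have h : y * x = x * (y * z) := by rw [hxy, mul_assoc]
        rw [eq_mul_inv_iff_mul_eq, mul_assoc, ← hzx.inv_right.eq, ← mul_assoc,
          eq_inv_mul_iff_mul_eq.2 h.symm, mul_assoc, mul_assoc, mul_inv_cancel, mul_one]
      rw [mul_pow_of_commutes_up_to h hzx.inv_left.inv_right hzy.inv_left, inv_pow, inv_pow, hxk,
        hyk, hz z hzm, inv_one, one_mul, one_mul]
  induction hx using Subgroup.closure_induction_left with
  | one => simp
  | mul_left x hx y hy ih =>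
    obtain ⟨n, hn, g, rfl | rfl⟩ := hx
    · exact (step _ (tmul_mem_mixed_left hn g) y hy (hgen n hn g).1 ih (hcomm n hn g y hy).1).1
    · exact (step _ (tmul_mem_mixed_right hn g) y hy (hgen n hn g).2 ih (hcomm n hn g y hy).2).1
  | inv_mul_cancel x hx y hy ih =>
    obtain ⟨n, hn, g, rfl | rfl⟩ := hx
    · exact (step _ (tmul_mem_mixed_left hn g) y hy (hgen n hn g).1 ih (hcomm n hn g y hy).1).2
    · exact (step _ (tmul_mem_mixed_right hn g) y hy (hgen n hn g).2 ih (hcomm n hn g y hy).2).2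

/-! ### Passage to the quotient and induction on the derived length -/

/-- Changing an argument by an element of `N` multiplies the symbol by a generator of `mixed N`;
this makes the representatives chosen in `ofQuotient` immaterial. -/
theorem mk_tmul_congr {g g' h h' : G} (hg : (g : G ⧸ N) = g') (hh : (h : G ⧸ N) = h') :
    (tmul g h : NATensorSquare G ⧸ mixed N) = tmul g' h' := by
  have key1 : ∀ g h : G, ∀ n ∈ N, (tmul (g * n) h : NATensorSquare G ⧸ mixed N) = tmul g h := by
    intro g h n hn
    rw [mul_tmul, QuotientGroup.mk_mul, (QuotientGroup.eq_one_iff _).2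
      (tmul_mem_mixed_left (hN.conj_mem _ hn g) _), one_mul]
  have key2 : ∀ g h : G, ∀ n ∈ N, (tmul g (h * n) : NATensorSquare G ⧸ mixed N) = tmul g h := by
    intro g h n hn
    rw [tmul_mul, QuotientGroup.mk_mul, (QuotientGroup.eq_one_iff _).2
      (tmul_mem_mixed_right (hN.conj_mem _ hn h) _), mul_one]
  have h1 := key1 g h _ (QuotientGroup.eq.1 hg)
  have h2 := key2 g' h _ (QuotientGroup.eq.1 hh)
  rw [mul_inv_cancel_left] at h1 h2
  rw [← h1, h2]

variable (N) in
/-- The homomorphism `G/N ⊗ G/N → (G ⊗ G) / mixed N`. -/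
noncomputable def ofQuotient : NATensorSquare (G ⧸ N) →* NATensorSquare G ⧸ mixed N :=
  PresentedGroup.toGroup
    (f := fun x : (G ⧸ N) × (G ⧸ N) => ((tmul x.1.out x.2.out : NATensorSquare G) : _ ⧸ mixed N))
    (by
      rintro r (⟨g, g', h, rfl⟩ | ⟨g, h, h', rfl⟩) <;>
      simp only [map_mul, map_inv, FreeGroup.lift_apply_of, mul_inv_eq_one]
      · rw [← QuotientGroup.mk_mul]
        refine (mk_tmul_congr ?_ ?_).trans (congrArg _ (mul_tmul g.out g'.out h.out)) |>.trans ?_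
        · simp
        · simp
        · rw [QuotientGroup.mk_mul, QuotientGroup.mk_mul]
          congr 1
          exact mk_tmul_congr (by simp) (by simp)
      · rw [← QuotientGroup.mk_mul]
        refine (mk_tmul_congr ?_ ?_).trans (congrArg _ (tmul_mul g.out h.out h'.out)) |>.trans ?_
        · simp
        · simp
        · rw [QuotientGroup.mk_mul, QuotientGroup.mk_mul]
          congr 1
          exact mk_tmul_congr (by simp) (by simp))

theorem ofQuotient_tmul (g h : G) :
    ofQuotient N (tmul (g : G ⧸ N) (h : G ⧸ N)) = (tmul g h : NATensorSquare G) := by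
  refine (PresentedGroup.toGroup.of _).trans ?_
  exact mk_tmul_congr (by simp) (by simp)

theorem ofQuotient_surjective : Function.Surjective (ofQuotient N) := by
  rw [← MonoidHom.range_eq_top, eq_top_iff, ← (Subgroup.map_top_of_surjective _
    (QuotientGroup.mk'_surjective (mixed N))), ← closure_tmul, MonoidHom.map_closure,
    Subgroup.closure_le]
  rintro _ ⟨_, ⟨⟨g, h⟩, rfl⟩, rfl⟩
  exact ⟨_, ofQuotient_tmul g h⟩

theorem pow_mul_eq_one (hc : ∀ a ∈ N, ∀ b ∈ N, Commute a b) {e k l : ℕ}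
    (he : ∀ g : G, g ^ e = 1) (hk : e ∣ k) (hk2 : e ∣ k.choose 2)
    (hl : ∀ y : NATensorSquare (G ⧸ N), y ^ l = 1) (x : NATensorSquare G) : x ^ (l * k) = 1 := by
  obtain ⟨y, hy⟩ := ofQuotient_surjective (N := N) (x : NATensorSquare G ⧸ mixed N)
  rw [pow_mul]
  refine pow_eq_one_of_mem_mixed hc he hk hk2 (N := N) ?_
  rw [← QuotientGroup.eq_one_iff, QuotientGroup.mk_pow, ← hy, ← map_pow, hl, map_one]

end NormalSubgroup

/-- Each of the `d` nonabelian layers costs `c * e` and the abelian base costs `e`; `c` will be `1`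
or `2` according to parity. -/
theorem pow_eq_one_of_derivedSeries_eq_bot {c e : ℕ} (hce : e ∣ (c * e).choose 2) (d : ℕ) :
    ∀ (G : Type u) [Group G], derivedSeries G (d + 1) = ⊥ → (∀ g : G, g ^ e = 1) →
      ∀ x : NATensorSquare G, x ^ (c ^ d * e ^ (d + 1)) = 1 := by
  have hcomm : ∀ (G : Type u) [Group G] (d : ℕ), derivedSeries G (d + 1) = ⊥ →
      ∀ a ∈ derivedSeries G d, ∀ b ∈ derivedSeries G d, Commute a b := by
    intro G _ d hd a ha b hb
    rw [← commutatorElement_eq_one_iff_commute, ← Subgroup.mem_bot, ← hd, derivedSeries_succ]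
    exact Subgroup.commutator_mem_commutator ha hb
  induction d with
  | zero =>
    intro G _ hd he x
    simpa using pow_eq_one_of_commutative
      (fun a b => hcomm G 0 hd a (Subgroup.mem_top a) b (Subgroup.mem_top b)) he x
  | succ d ih =>
    intro G _ hd he x
    have hQ : derivedSeries (G ⧸ derivedSeries G (d + 1)) (d + 1) = ⊥ := by
      rw [← map_derivedSeries_eq (QuotientGroup.mk'_surjective (derivedSeries G (d + 1))),
        QuotientGroup.map_mk'_self]
    have heQ : ∀ g : G ⧸ derivedSeries G (d + 1), g ^ e = 1 := by
      intro g
      induction g using QuotientGroup.induction_on with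
      | H g => rw [← QuotientGroup.mk_pow, he, QuotientGroup.mk_one]
    have h := pow_mul_eq_one (hcomm G (d + 1) hd) he (Dvd.intro_left c rfl) hce
      (ih (G ⧸ derivedSeries G (d + 1)) hQ heQ) x
    rwa [show c ^ d * e ^ (d + 1) * (c * e) = c ^ (d + 1) * e ^ (d + 1 + 1) by ring] at h

end NATensorSquare

/-! ### Commutators in central extensions -/

theorem commutatorElement_eq_of_map_eq {E G : Type*} [Group E] [Group G] (π : E →* G)
    (hπ : π.ker ≤ Subgroup.center E) {x x' y y' : E} (hx : π x = π x') (hy : π y = π y') :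
    ⁅x, y⁆ = ⁅x', y'⁆ := by
  have key : ∀ {x x' : E}, π x = π x' → ∃ z ∈ Subgroup.center E, x = x' * z := fun {x x'} h =>
    ⟨x'⁻¹ * x, hπ (by rw [MonoidHom.mem_ker, map_mul, map_inv, h, inv_mul_cancel]), by group⟩
  obtain ⟨z, hz, rfl⟩ := key hx
  obtain ⟨w, hw, rfl⟩ := key hy
  rw [Subgroup.mem_center_iff] at hz hw
  have h1 : x' * z * (y' * w) = x' * y' * (z * w) := by
    rw [mul_assoc, ← mul_assoc z, ← hz y']; simp only [mul_assoc]
  have h2 : y' * w * (x' * z) = y' * x' * (z * w) := by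
    rw [mul_assoc, ← mul_assoc w, ← hw x', mul_assoc, mul_assoc, ← hz w]
  have h3 : ∀ a b : E, ⁅a, b⁆ = a * b * (b * a)⁻¹ := fun a b => by
    rw [commutatorElement_def, mul_inv_rev, mul_assoc (a * b)]
  rw [h3, h1, h2, h3]
  group

namespace NATensorSquare

variable {G : Type u} [Group G] {E : Type*} [Group E]

/-- The commutator pairing `G ⊗ G → E` of a central extension `E` of `G`. -/
def commutatorPairing (π : E →* G) (hπ : π.ker ≤ Subgroup.center E) (s : G → E)
    (hs : ∀ g, π (s g) = g) : NATensorSquare G →* E :=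
  PresentedGroup.toGroup (f := fun x : G × G => ⁅s x.1, s x.2⁆)
    (by
      rintro r (⟨g, g', h, rfl⟩ | ⟨g, h, h', rfl⟩) <;>
      simp only [map_mul, map_inv, FreeGroup.lift_apply_of, mul_inv_eq_one]
      · rw [commutatorElement_eq_of_map_eq π hπ (x' := s g * s g') (y' := s h) (by simp [hs]) rfl,
          commutatorElement_eq_of_map_eq π hπ (x := s (g * g' * g⁻¹)) (x' := s g * s g' * (s g)⁻¹)
            (y' := s g * s h * (s g)⁻¹) (by simp [hs]) (by simp [hs])]
        simp only [commutatorElement_def]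
        group
      · rw [commutatorElement_eq_of_map_eq π hπ (y' := s h * s h') (x' := s g) rfl (by simp [hs]),
          commutatorElement_eq_of_map_eq π hπ (x := s (h * g * h⁻¹)) (x' := s h * s g * (s h)⁻¹)
            (y' := s h * s h' * (s h)⁻¹) (by simp [hs]) (by simp [hs])]
        simp only [commutatorElement_def]
        group)

/-- A commutator in `E` depends only on the images of its entries in `G`, so it is the value of the
pairing on a single symbol, whatever the section. -/
theorem commutator_le_range_commutatorPairing (π : E →* G) (hπ : π.ker ≤ Subgroup.center E)
    (s : G → E) (hs : ∀ g, π (s g) = g) :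
    commutator E ≤ (commutatorPairing π hπ s hs).range := by
  rw [commutator_eq_closure, Subgroup.closure_le]
  rintro _ ⟨x, y, rfl⟩
  refine ⟨tmul (π x) (π y), ?_⟩
  refine (PresentedGroup.toGroup.of _).trans ?_
  exact commutatorElement_eq_of_map_eq π hπ (hs _) (hs _)

theorem pow_eq_one_of_mem_commutator (π : E →* G) (hπ : π.ker ≤ Subgroup.center E)
    (s : G → E) (hs : ∀ g, π (s g) = g) {k : ℕ} (hk : ∀ x : NATensorSquare G, x ^ k = 1) {x : E}
    (hx : x ∈ commutator E) : x ^ k = 1 := by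
  obtain ⟨y, rfl⟩ := commutator_le_range_commutatorPairing π hπ s hs hx
  rw [← map_pow, hk, map_one]

end NATensorSquare

/-! ### The Schur multiplier inside a tautological central extension -/

namespace groupHomology

/-- The trivial representation of `G` on (a universe lift of) the integers. -/
abbrev trivialInt (G : Type u) [Group G] : Rep (ULift.{u} ℤ) G :=
  Rep.trivial (ULift.{u} ℤ) G (ULift.{u} ℤ)

/-- Inhomogeneous integral two-chains modulo boundaries. -/
abbrev ChainsModBoundaries (G : Type u) [Group G] : Type u :=
  (G × G →₀ trivialInt G) ⧸ boundaries₂ (trivialInt G)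

variable {G : Type u} [Group G]

/-- The tautological two-cocycle of `G` with values in two-chains modulo boundaries. -/
noncomputable def tautCocycle (g h : G) : ChainsModBoundaries G :=
  Submodule.Quotient.mk (Finsupp.single (g, h) (1 : ULift.{u} ℤ))

theorem tautCocycle_add (g h k : G) :
    tautCocycle g h + tautCocycle (g * h) k = tautCocycle h k + tautCocycle g (h * k) := by
  -- The cocycle identity is the vanishing of the boundary of the 3-chain `(g, h, k)`.
  have hmem : d₃₂ (trivialInt G) (Finsupp.single (g, h, k) (1 : ULift.{u} ℤ)) ∈
      boundaries₂ (trivialInt G) := ⟨_, rfl⟩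
  rw [d₃₂_single, ← Submodule.Quotient.mk_eq_zero] at hmem
  simp only [Submodule.Quotient.mk_sub, Submodule.Quotient.mk_add] at hmem
  change tautCocycle h k - tautCocycle (g * h) k + tautCocycle g (h * k) - tautCocycle g h = 0
    at hmem
  rw [← sub_eq_zero, ← neg_eq_zero, ← hmem]
  abel

/-- The central extension of `G` by two-chains modulo boundaries given by the tautological
cocycle. -/
@[ext]
structure TautExtension (G : Type u) [Group G] where
  /-- The central component. -/
  fst : ChainsModBoundaries G
  /-- The image in `G`. -/
  snd : G

namespace TautExtension

noncomputable instance : Mul (TautExtension G) :=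
  ⟨fun x y => ⟨x.fst + y.fst + tautCocycle x.snd y.snd, x.snd * y.snd⟩⟩

/-- The cocycle is not normalized, so the identity and the inclusion of the central subgroup are
shifted by `tautCocycle 1 1`. -/
noncomputable instance : One (TautExtension G) := ⟨⟨-tautCocycle 1 1, 1⟩⟩

noncomputable instance : Inv (TautExtension G) :=
  ⟨fun x => ⟨-x.fst - tautCocycle x.snd⁻¹ x.snd - tautCocycle 1 1, x.snd⁻¹⟩⟩

@[simp] theorem fst_mul (x y : TautExtension G) :
    (x * y).fst = x.fst + y.fst + tautCocycle x.snd y.snd := rfl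

@[simp] theorem snd_mul (x y : TautExtension G) : (x * y).snd = x.snd * y.snd := rfl

@[simp] theorem fst_one : (1 : TautExtension G).fst = -tautCocycle 1 1 := rfl

@[simp] theorem snd_one : (1 : TautExtension G).snd = 1 := rfl

@[simp] theorem fst_inv (x : TautExtension G) :
    x⁻¹.fst = -x.fst - tautCocycle x.snd⁻¹ x.snd - tautCocycle 1 1 := rfl

@[simp] theorem snd_inv (x : TautExtension G) : x⁻¹.snd = x.snd⁻¹ := rfl

theorem tautCocycle_one_left (g : G) : tautCocycle 1 g = tautCocycle 1 1 := by
  have h := tautCocycle_add 1 1 g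
  simp only [one_mul] at h
  exact (add_right_cancel h).symm

theorem tautCocycle_one_right (g : G) : tautCocycle g 1 = tautCocycle 1 1 := by
  have h := tautCocycle_add g 1 1
  simp only [mul_one] at h
  exact add_right_cancel h

noncomputable instance : Group (TautExtension G) :=
  Group.ofLeftAxioms
    (by
      intro x y z
      refine TautExtension.ext ?_ (mul_assoc _ _ _)
      have h := tautCocycle_add x.snd y.snd z.snd
      simp only [fst_mul, snd_mul]
      calc _ = x.fst + y.fst + z.fst +
            (tautCocycle x.snd y.snd + tautCocycle (x.snd * y.snd) z.snd) := by abel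
        _ = _ := by rw [h]; abel)
    (by
      intro x
      refine TautExtension.ext ?_ (one_mul _)
      simp only [fst_mul, fst_one, snd_one, tautCocycle_one_left x.snd]
      abel)
    (by
      intro x
      refine TautExtension.ext ?_ (inv_mul_cancel _)
      simp only [fst_mul, fst_one, fst_inv, snd_inv]
      abel)

/-- The projection of the extension onto `G`. -/
def proj (G : Type u) [Group G] : TautExtension G →* G where
  toFun := snd
  map_one' := rfl
  map_mul' _ _ := rfl

theorem ker_proj_le_center : (proj G).ker ≤ Subgroup.center (TautExtension G) := by
  intro x hx
  have hx : x.snd = 1 := hx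
  rw [Subgroup.mem_center_iff]
  intro y
  refine TautExtension.ext ?_ (by simp [hx])
  simp only [fst_mul, hx, tautCocycle_one_left y.snd, tautCocycle_one_right y.snd]
  abel

/-- The inclusion of the central subgroup. -/
noncomputable def incl (G : Type u) [Group G] :
    Multiplicative (ChainsModBoundaries G) →* TautExtension G where
  toFun a := ⟨a.toAdd - tautCocycle 1 1, 1⟩
  map_one' := TautExtension.ext (by simp) rfl
  map_mul' a b := by
    refine TautExtension.ext ?_ (one_mul _).symm
    simp only [fst_mul, toAdd_mul]
    abel

theorem incl_injective : Function.Injective (incl G) := by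
  intro a b h
  exact Multiplicative.toAdd.injective (sub_left_injective (congrArg fst h))

/-- The set-theoretic section of the projection. -/
noncomputable def lift (g : G) : TautExtension G := ⟨0, g⟩

theorem lift_mul_lift (g h : G) :
    lift g * lift h = incl G (Multiplicative.ofAdd (tautCocycle g h)) * lift (g * h) := by
  refine TautExtension.ext ?_ (one_mul _).symm
  simp only [lift, incl, fst_mul, MonoidHom.coe_mk, OneHom.coe_mk, toAdd_ofAdd,
    tautCocycle_one_left (g * h)]
  abel

/-- The additive extension of the section to one-chains, with values in the abelianization. -/
noncomputable def chainLift (G : Type u) [Group G] :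
    (G →₀ trivialInt G) →+ Additive (Abelianization (TautExtension G)) :=
  Finsupp.liftAddHom fun g =>
    ((zmultiplesHom _ (Additive.ofMul (Abelianization.of (lift g)))).comp
      (AddEquiv.ulift (α := ℤ)).toAddMonoidHom :)

theorem chainLift_single (g : G) :
    chainLift G (Finsupp.single g (1 : ULift.{u} ℤ)) =
      Additive.ofMul (Abelianization.of (lift g)) := by
  refine (Finsupp.liftAddHom_apply_single _ _ _).trans ?_
  exact one_zsmul _

/-- The class of a two-chain in the abelianization of the extension. -/
noncomputable def chainClass (G : Type u) [Group G] :
    (G × G →₀ trivialInt G) →+ Additive (Abelianization (TautExtension G)) :=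
  (MonoidHom.toAdditiveRight (Abelianization.of.comp (incl G) :)).comp
    (boundaries₂ (trivialInt G)).mkQ.toAddMonoidHom

/-- On a basis chain `(g, h)` this is `lift g * lift h = incl (tautCocycle g h) * lift (g * h)` read
in the abelianization. -/
theorem chainClass_eq (c : G × G →₀ trivialInt G) :
    chainClass G c = chainLift G (d₂₁ (trivialInt G) c) := by
  have h : chainClass G =
      (chainLift G).comp (d₂₁ (trivialInt G)).hom.toAddMonoidHom := by
    refine Finsupp.addHom_ext' fun x => ?_
    obtain ⟨g, h⟩ := x
    have hext : ∀ f₁ f₂ : ULift.{u} ℤ →+ Additive (Abelianization (TautExtension G)),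
        f₁ 1 = f₂ 1 → f₁ = f₂ := by
      intro f₁ f₂ h
      have h' : f₁.comp (AddEquiv.ulift (α := ℤ)).symm.toAddMonoidHom =
          f₂.comp (AddEquiv.ulift (α := ℤ)).symm.toAddMonoidHom := AddMonoidHom.ext_int h
      ext n
      exact DFunLike.congr_fun h' n.down
    refine hext _ _ ?_
    change Additive.ofMul (Abelianization.of (incl G (Multiplicative.ofAdd (tautCocycle g h)))) =
      chainLift G (d₂₁ (trivialInt G) (Finsupp.single (g, h) (1 : ULift.{u} ℤ)))
    rw [d₂₁_single, map_add, map_sub]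
    change _ = chainLift G (Finsupp.single h (1 : ULift.{u} ℤ)) -
      chainLift G (Finsupp.single (g * h) (1 : ULift.{u} ℤ)) +
      chainLift G (Finsupp.single g (1 : ULift.{u} ℤ))
    have hab : Abelianization.of (incl G (Multiplicative.ofAdd (tautCocycle g h))) =
        Abelianization.of (lift g) * Abelianization.of (lift h) *
          (Abelianization.of (lift (g * h)))⁻¹ := by
      rw [eq_mul_inv_of_mul_eq (lift_mul_lift g h).symm, map_mul, map_mul, map_inv]
    rw [chainLift_single, chainLift_single, chainLift_single, hab, ofMul_mul, ofMul_mul, ofMul_inv]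
    abel
  exact DFunLike.congr_fun h c

/-- A cycle has zero boundary, so its class dies in the abelianization. -/
theorem incl_mem_commutator {c : G × G →₀ trivialInt G} (hc : c ∈ cycles₂ (trivialInt G)) :
    incl G (Multiplicative.ofAdd (Submodule.Quotient.mk c)) ∈ commutator (TautExtension G) := by
  have h := chainClass_eq c
  rw [show d₂₁ (trivialInt G) c = 0 from hc, map_zero] at h
  rw [← Abelianization.ker_of]
  exact h

end TautExtension

theorem nsmul_H2_eq_zero {k : ℕ} (hk : ∀ x : NATensorSquare G, x ^ k = 1)
    (x : H2 (trivialInt G)) : k • x = 0 := by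
  induction x using H2_induction_on with
  | h c =>
    rw [← map_nsmul, H2π_eq_zero_iff, ← Submodule.Quotient.mk_eq_zero]
    have h := NATensorSquare.pow_eq_one_of_mem_commutator (TautExtension.proj G)
      TautExtension.ker_proj_le_center TautExtension.lift (fun _ => rfl) hk
      (TautExtension.incl_mem_commutator c.2)
    rw [← map_pow, ← map_one (TautExtension.incl G)] at h
    exact Multiplicative.ofAdd.injective (TautExtension.incl_injective h)

end groupHomology

/-! ### Assembly of the three bounds -/

theorem exponents_dvd_of_pow_eq_one {G : Type u} [Group G] {k : ℕ}
    (hk : ∀ x : NATensorSquare G, x ^ k = 1) :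
    Monoid.exponent (NATensorSquare G) ∣ k ∧ AddMonoid.exponent (IntegralH2 G) ∣ k ∧
      Monoid.exponent (kerCommutatorMap G) ∣ k := by
  refine ⟨Monoid.exponent_dvd_of_forall_pow_eq_one hk,
    AddMonoid.exponent_dvd_of_forall_nsmul_eq_zero (groupHomology.nsmul_H2_eq_zero hk),
    Monoid.exponent_dvd_of_forall_pow_eq_one ?_⟩
  rintro ⟨x, hx⟩
  refine Subtype.ext ?_
  change x ^ k = 1
  induction x using QuotientGroup.induction_on with
  | H x => rw [← QuotientGroup.mk_pow, hk, QuotientGroup.mk_one]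

theorem derivedSeries_derivedLength (G : Type u) [Group G] [Group.IsSolvable G] :
    derivedSeries G (derivedLength G) = ⊥ :=
  Nat.sInf_mem (s := {n | derivedSeries G n = ⊥}) Group.IsSolvable.solvable

theorem theorem6p3 (G : Type u) [Group G] [Group.IsSolvable G] (d : ℕ) (hd : derivedLength G = d) :
    (Odd (Monoid.exponent G) →
      Monoid.exponent (NATensorSquare G) ∣ Monoid.exponent G ^ d ∧
      AddMonoid.exponent (IntegralH2 G) ∣ Monoid.exponent G ^ d ∧
      Monoid.exponent (kerCommutatorMap G) ∣ Monoid.exponent G ^ d) ∧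
    (Even (Monoid.exponent G) →
      Monoid.exponent (NATensorSquare G) ∣ 2 ^ (d - 1) * Monoid.exponent G ^ d ∧
      AddMonoid.exponent (IntegralH2 G) ∣ 2 ^ (d - 1) * Monoid.exponent G ^ d ∧
      Monoid.exponent (kerCommutatorMap G) ∣ 2 ^ (d - 1) * Monoid.exponent G ^ d) := by
  have hbot : derivedSeries G d = ⊥ := hd ▸ derivedSeries_derivedLength G
  have hexp : ∀ g : G, g ^ Monoid.exponent G = 1 := Monoid.pow_exponent_eq_one
  generalize Monoid.exponent G = e at hexp ⊢
  obtain _ | d := d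
  -- For `d = 0` the group is trivial and both bounds equal `1`, as `0 - 1 = 0` in `ℕ`; the abelian
  -- base case is applied with exponent `1`.
  · have htriv : ∀ g : G, g ^ 1 = 1 := fun g => by
      have hg : g ∈ derivedSeries G 0 := Subgroup.mem_top g
      rw [hbot, Subgroup.mem_bot] at hg
      rw [hg, one_pow]
    have h := NATensorSquare.pow_eq_one_of_derivedSeries_eq_bot (c := 1) (e := 1) (one_dvd _) 0 G
      (by rw [derivedSeries_succ, hbot, Subgroup.commutator_bot_left]) htriv
    have := exponents_dvd_of_pow_eq_one h
    exact ⟨fun _ => by simpa using this, fun _ => by simpa using this⟩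
  refine ⟨fun ho => ?_, fun _ => ?_⟩
  -- For `e = 2m + 1`, `e.choose 2 = e * m`.
  · have hdvd : e ∣ (1 * e).choose 2 := by
      obtain ⟨m, rfl⟩ := ho
      rw [one_mul, Nat.choose_two_right, Nat.add_sub_cancel, mul_left_comm,
        Nat.mul_div_cancel_left _ two_pos]
      exact dvd_mul_right _ _
    have := exponents_dvd_of_pow_eq_one
      (NATensorSquare.pow_eq_one_of_derivedSeries_eq_bot hdvd d G hbot hexp)
    simpa using this
  -- Here `(2 * e).choose 2 = e * (2 * e - 1)`, which holds for every `e`.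
  · have hdvd : e ∣ (2 * e).choose 2 := by
      rw [Nat.choose_two_right, mul_assoc, Nat.mul_div_cancel_left _ two_pos]
      exact dvd_mul_right _ _
    exact exponents_dvd_of_pow_eq_one
      (NATensorSquare.pow_eq_one_of_derivedSeries_eq_bot hdvd d G hbot hexp)
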